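/- All graphs are finite and simple. Let $G_B$ be a graph on the vertex set $\{1,2,3,4\}$ and $G_C$ a graph on $n$ vertices, with adjacency matrices $B$ and $C$. A $4\times n$ matrix $N$ with entries in $\{0,1\}$ is called GM-admissible if each of its columns contains exactly $0$, $2$ or $4$ ones. For such $N$ let $G=G(B,C,N)$ be the (labeled) graph on $4+n$ vertices with adjacency matrix $$\begin{bmatrix} B & N\\ {}^tN & C\end{bmatrix},$$ and let $\tilde G=G(B,C,\tilde N)$ be its GM switch, where $\tilde N$ is obtained from $N$ by replacing each column $\mathbf v$ with exactly two ones by $\mathbf 1-\mathbf v$. For a graph $G$, a closed geodesic of length $\ell$ is a closed walk $(e_1,\dots,e_\ell)$ of oriented edges with $e_i\neq e_{i+1}^{-1}$ for $1\le i<\ell$ and $e_1\ne e_\ell^{-1}$; it is primitive if it is not the concatenation of $k\ge 2$ copies of a closed geodesic. Let $a_G(\ell)$ be the number of primitive closed geodesics of length $\ell$ up to cyclic shifts. The Ihara zeta function of $G$ is $$Z_G(t)=\prod_{\ell>2}(1-t^\ell)^{-a_G(\ell)},$$ regarded as a power series in $t$. Write $G^*=G\vee K_1$ for the cone of $G$ (a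 new vertex joined to all vertices of $G$). A graph is md$k$ if all of its vertices have degree at least $k$. **Theorem.** For every $\varepsilon>0$ there is an $n_0$ such that for all $n\ge n_0$ and every regular graph $G_B$ on $4$ vertices the following hold. 1. For every md1 graph $G_C$ on $n$ vertices, the proportion, among all GM-admissible $N$, of those with $Z_{G^*}\ne Z_{\tilde G^*}$ is greater than $1-\varepsilon$. 2. For every md2 graph $G_C$ on $n$ vertices, the proportion, among all GM-admissible $N$, of those with $Z_{G}\ne Z_{\tilde G}$ is greater than $1-\varepsilon$. In other words, the proportion of GM-admissible $N$ for which the pair of labeled graphs $(G,\tilde G)$ is distinguished by $Z^*$ (resp. by $Z$) tends to $1$ as $n\to\infty$, uniformly in $G_B$ and $G_C$. -/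

import Mathlib

/-! ### Closed geodesics and the Ihara zeta function of a finite simple graph -/

namespace SimpleGraph

/-- A cyclic sequence `γ 0, …, γ (ℓ - 1)` of oriented edges (indices modulo `ℓ`) of `G` is a
closed geodesic of length `ℓ` if it is a closed walk (each edge ends where the cyclically next one
starts) and no edge is followed cyclically by its own inverse (no backtracking and no tails). -/
def IsClosedGeodesic {V : Type*} (G : SimpleGraph V) {ℓ : ℕ} (γ : ZMod ℓ → G.Dart) : Prop :=
  ∀ i : ZMod ℓ, (γ i).snd = (γ (i + 1)).fst ∧ γ i ≠ (γ (i + 1)).symm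

/-- A closed geodesic `γ` is primitive if it is not of the form `k δ` with `δ` a closed geodesic and
`k ≥ 2`. Here `k δ` is the concatenation of `k` copies of `δ`: it has length `k * d`, where `d` is
the length of `δ`, and its edge at `i` is the edge of `δ` at `i` modulo `d`. -/
def IsPrimitiveClosedGeodesic {V : Type*} (G : SimpleGraph V) {ℓ : ℕ} (γ : ZMod ℓ → G.Dart) :
    Prop :=
  G.IsClosedGeodesic γ ∧
    ¬ ∃ (k d : ℕ) (h : ℓ = k * d) (δ : ZMod d → G.Dart),
      2 ≤ k ∧ G.IsClosedGeodesic δ ∧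
        ∀ i : ZMod ℓ, γ i = δ (ZMod.castHom (Dvd.intro_left k h.symm) (ZMod d) i)

/-- Two primitive closed geodesics of the same length are equivalent if one is obtained from the
other by cyclically shifting the edges. -/
def primitiveGeodesicSetoid {V : Type*} (G : SimpleGraph V) (ℓ : ℕ) :
    Setoid {γ : ZMod ℓ → G.Dart // G.IsPrimitiveClosedGeodesic γ} where
  r γ γ' := ∃ s : ZMod ℓ, ∀ i : ZMod ℓ, γ'.1 i = γ.1 (i + s)
  iseqv :=
    { refl := fun γ => ⟨0, fun i => by rw [add_zero]⟩
      symm := by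
        rintro γ γ' ⟨s, hs⟩
        exact ⟨-s, fun i => by rw [hs, neg_add_cancel_right]⟩
      trans := by
        rintro γ γ' γ'' ⟨s, hs⟩ ⟨t, ht⟩
        exact ⟨t + s, fun i => by rw [ht, hs, add_assoc]⟩ }

/-- `a_G(ℓ)`: the number of primitive closed geodesics of length `ℓ ≥ 1` up to equivalence. -/
noncomputable def numPrimitiveGeodesics {V : Type*} (G : SimpleGraph V) (ℓ : ℕ) : ℕ :=
  Nat.card (Quotient (G.primitiveGeodesicSetoid ℓ))

/-- The partial Euler product `∏_{2 < ℓ ≤ M} (1 - t ^ ℓ) ^ (- a_G(ℓ))`, as a power series. -/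
noncomputable def iharaPartialProduct {V : Type*} (G : SimpleGraph V) (M : ℕ) : PowerSeries ℂ :=
  ∏ ℓ ∈ Finset.Icc 3 M,
    ((1 - (PowerSeries.X : PowerSeries ℂ) ^ ℓ)⁻¹) ^ G.numPrimitiveGeodesics ℓ

/-- The Ihara zeta function `Z_G(t) = ∏_{ℓ > 2} (1 - t ^ ℓ) ^ (- a_G(ℓ))`, as a power series in `t`.
The factors with `ℓ > k` are congruent to `1` modulo `t ^ (k + 1)`, so that the coefficient of `t ^ k`
of the infinite product is that of the product over `ℓ ≤ k`; see `coeff_iharaPartialProduct`. -/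
noncomputable def iharaZeta {V : Type*} (G : SimpleGraph V) : PowerSeries ℂ :=
  PowerSeries.mk fun k => PowerSeries.coeff k (G.iharaPartialProduct k)

/-- The partial Euler products converge coefficientwise to `iharaZeta`. -/
theorem coeff_iharaPartialProduct {V : Type*} (G : SimpleGraph V) {k M : ℕ} (h : k ≤ M) :
    PowerSeries.coeff k (G.iharaPartialProduct M) = PowerSeries.coeff k G.iharaZeta := by
  rw [iharaZeta, PowerSeries.coeff_mk]
  induction M, h using Nat.le_induction with
  | base => rfl
  | succ M hM ih =>
    rw [← ih]
    by_cases h3 : 3 ≤ M + 1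
    · have hf : (PowerSeries.X : PowerSeries ℂ) ^ (M + 1) ∣
          ((1 - (PowerSeries.X : PowerSeries ℂ) ^ (M + 1))⁻¹) ^
            G.numPrimitiveGeodesics (M + 1) - 1 := by
        refine dvd_trans ?_ (sub_one_dvd_pow_sub_one _ _)
        have hc : PowerSeries.constantCoeff
            (1 - (PowerSeries.X : PowerSeries ℂ) ^ (M + 1)) ≠ 0 := by
          simp
        have hm := PowerSeries.mul_inv_cancel _ hc
        refine ⟨(1 - (PowerSeries.X : PowerSeries ℂ) ^ (M + 1))⁻¹, ?_⟩
        linear_combination hm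
      obtain ⟨q, hq⟩ := hf
      have hstep : G.iharaPartialProduct (M + 1) = G.iharaPartialProduct M +
          (PowerSeries.X : PowerSeries ℂ) ^ (M + 1) * (q * G.iharaPartialProduct M) := by
        rw [iharaPartialProduct, Finset.prod_Icc_succ_top h3, ← iharaPartialProduct]
        linear_combination (G.iharaPartialProduct M) * hq
      rw [hstep, map_add, PowerSeries.coeff_X_pow_mul', if_neg (by omega), add_zero]
    · rw [iharaPartialProduct, iharaPartialProduct, Finset.Icc_eq_empty (by omega),
        Finset.Icc_eq_empty (by omega)]

/-! ### Cones and minimal degrees -/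

/-- The join `G ∨ H`: the disjoint union of `G` and `H` together with all edges between them. -/
def joinGraph {V W : Type*} (G : SimpleGraph V) (H : SimpleGraph W) : SimpleGraph (V ⊕ W) :=
  (G ⊕g H) ⊔ completeBipartiteGraph V W

/-- The cone `G^* = G ∨ K_1` of `G`. -/
def cone {V : Type*} (G : SimpleGraph V) : SimpleGraph (V ⊕ Unit) :=
  G.joinGraph (⊤ : SimpleGraph Unit)

/-- The zeta function `Z_{G^*}` of the cone of `G`. -/
noncomputable def coneZeta {V : Type*} (G : SimpleGraph V) : PowerSeries ℂ :=
  G.cone.iharaZeta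

/-- `G` is md`k` if every vertex has degree at least `k`. -/
def IsMd {V : Type*} (G : SimpleGraph V) [G.LocallyFinite] (k : ℕ) : Prop :=
  ∀ v : V, k ≤ G.degree v

end SimpleGraph

/-! ### Godsil-McKay switching with two blocks -/

namespace GMSwitching

/-- The graph whose adjacency matrix is `[[B, N], [Nᵀ, C]]`, where `B` and `C` are the adjacency
matrices of `GB` and `GC` and `N` is a zero-one matrix (`true` stands for `1`). -/
def blockGraph {β γ : Type*} (GB : SimpleGraph β) (GC : SimpleGraph γ) (N : Matrix β γ Bool) :
    SimpleGraph (β ⊕ γ) where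
  Adj
    | Sum.inl b, Sum.inl b' => GB.Adj b b'
    | Sum.inr c, Sum.inr c' => GC.Adj c c'
    | Sum.inl b, Sum.inr c => N b c = true
    | Sum.inr c, Sum.inl b => N b c = true
  symm.symm
    | Sum.inl _, Sum.inl _ => GB.adj_symm
    | Sum.inr _, Sum.inr _ => GC.adj_symm
    | Sum.inl _, Sum.inr _ => id
    | Sum.inr _, Sum.inl _ => id
  loopless.irrefl
    | Sum.inl _ => GB.irrefl
    | Sum.inr _ => GC.irrefl

/-- The number of ones in the column `c` of `N`. -/
def colOnes {β γ : Type*} [Fintype β] (N : Matrix β γ Bool) (c : γ) : ℕ :=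
  (Finset.univ.filter fun b => N b c = true).card

/-- `N` is GM-admissible if each of its columns has exactly `0`, `|β| / 2` or `|β|` ones. -/
def Admissible {β γ : Type*} [Fintype β] (N : Matrix β γ Bool) : Prop :=
  ∀ c : γ, colOnes N c = 0 ∨ 2 * colOnes N c = Fintype.card β ∨ colOnes N c = Fintype.card β

/-- The matrix obtained from `N` by replacing each column with exactly `|β| / 2` ones by its
complement. -/
def switchMatrix {β γ : Type*} [Fintype β] (N : Matrix β γ Bool) : Matrix β γ Bool :=
  fun b c => if 2 * colOnes N c = Fintype.card β then !(N b c) else N b c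

/-- The GM switch of `blockGraph GB GC N`. -/
def switchedGraph {β γ : Type*} [Fintype β] (GB : SimpleGraph β) (GC : SimpleGraph γ)
    (N : Matrix β γ Bool) : SimpleGraph (β ⊕ γ) :=
  blockGraph GB GC (switchMatrix N)

/-- The proportion, among all GM-admissible `N`, of those for which the graph given by
`(GB, GC, N)` and its GM switch have different values of the invariant `Z`. -/
noncomputable def distinguishedProportion {β γ : Type*} [Fintype β] (GB : SimpleGraph β)
    (GC : SimpleGraph γ) (Z : SimpleGraph (β ⊕ γ) → PowerSeries ℂ) : ℝ :=
  (Set.ncard {N : Matrix β γ Bool |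
      Admissible N ∧ Z (blockGraph GB GC N) ≠ Z (switchedGraph GB GC N)} : ℝ) /
    (Set.ncard {N : Matrix β γ Bool | Admissible N} : ℝ)

end GMSwitching

/-!
By Ihara's theorem the reciprocal of the zeta function is `det (1 - t T)`, where `T` is the
non-backtracking matrix on oriented edges, and its leading coefficient is, up to a sign depending on
the number of edges only, `det T = ± ∏ (1 - deg v)`. Hence the zeta function, together with the
number of edges, determines `∏ (1 - deg v)`, and this product already separates most `N` from their
switches.

Only the following part of Ihara's theorem is needed. The zeta function determines the numbers
`a(ℓ)` (`numPrimitiveGeodesics_eq_of_iharaZeta_eq`), hence the numbers `∑_{d ∣ ℓ} d a(d)` of closed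
geodesics of length `ℓ` (`card_closedGeodesics`). These are the traces of the powers `T ^ ℓ`
(`Matrix.trace_pow_of_relation`), which by Newton's identities determine `det T`
(`Matrix.det_eq_of_trace_pow_eq`). After composition with the reversal of edges, `T` is block
diagonal with one block `J - 1` for each vertex, which gives `det T` (`det_edgeMatrix`).

Switching preserves the degrees of the vertices of `GC`. Their factors are nonzero by the hypothesis
on minimal degrees, so they cancel. As `GB` is regular, switching reflects the degrees of its four
vertices in their mean. Writing `deg v_b - 1 = m + y_b` with `∑ y_b = 0`, equality of the products
means `∏ (m + y_b) = ∏ (m - y_b)`, that is, `m (y₀ + y₁) (y₀ + y₂) (y₀ + y₃) = 0`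
(`exists_rowForm_eq`). So one of four sums over the columns of `N` of a nonconstant weight takes
a prescribed value. The columns of an admissible `N` are arbitrary elements of a finite set, so each
such event has a proportion tending to `0`, uniformly in the value
(`exists_forall_card_sum_weight_le`): the proportion is a Fourier coefficient of `φ ^ n`, where `φ`
is the characteristic function of the weight of one column, and `|φ| < 1` almost everywhere.
-/

/-! ### Anticoncentration of sums of weights -/

open MeasureTheory Filter Topology in
theorem tendsto_integral_pow_zero {f : ℝ → ℂ} {s : Set ℝ} (hs : volume s ≠ ⊤)
    (hf : Continuous f) (hle : ∀ x, ‖f x‖ ≤ 1) (hlt : ∀ᵐ x, ‖f x‖ < 1) :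
    Tendsto (fun n : ℕ => ∫ x in s, ‖f x‖ ^ n) atTop (𝓝 0) := by
  have h := tendsto_integral_of_dominated_convergence (μ := volume.restrict s)
    (F := fun n : ℕ => fun x => ‖f x‖ ^ n) (f := fun _ => (0 : ℝ)) (fun _ => 1)
    (fun n => ((hf.norm.pow n).aestronglyMeasurable)) ?_ ?_ ?_
  · simpa using h
  · simp [isFiniteMeasure_restrict, hs]
  · intro n
    refine Eventually.of_forall fun x => ?_
    rw [norm_pow, norm_norm]
    exact pow_le_one₀ (norm_nonneg _) (hle x)
  · filter_upwards [ae_restrict_of_ae hlt] with x hx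
    exact tendsto_pow_atTop_nhds_zero_of_lt_one (norm_nonneg _) hx

theorem Complex.integral_exp_int_mul_I (k : ℤ) :
    ∫ t in (0 : ℝ)..2 * Real.pi, Complex.exp (k * t * Complex.I) =
      if k = 0 then 2 * (Real.pi : ℂ) else 0 := by
  split_ifs with h
  · simp [h]
  · have hc : (k * Complex.I : ℂ) ≠ 0 := by simp [h]
    have := integral_exp_mul_complex (a := 0) (b := 2 * Real.pi) hc
    have e : ∀ t : ℝ, Complex.exp (k * t * Complex.I) = Complex.exp (k * Complex.I * t) := by
      intro t; congr 1; ring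
    simp_rw [e]
    rw [this]
    have : Complex.exp (k * Complex.I * (2 * Real.pi : ℝ)) = 1 := by
      rw [Complex.exp_eq_one_iff]
      exact ⟨k, by push_cast; ring⟩
    rw [this]; simp

/-- The characteristic function of a sum of independent weights, without normalisation. -/
theorem Complex.sum_exp_pow {A : Type*} [Fintype A] [DecidableEq A] (w : A → ℤ) (n : ℕ) (t : ℝ) :
    (∑ a, Complex.exp (w a * t * Complex.I)) ^ n =
      ∑ N : Fin n → A, Complex.exp ((∑ c, w (N c) : ℤ) * t * Complex.I) := by
  have := Finset.prod_univ_sum (fun _ : Fin n => (Finset.univ : Finset A))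
    (fun _ a => Complex.exp (w a * t * Complex.I))
  rw [Finset.prod_const, Finset.card_univ, Fintype.card_fin, Fintype.piFinset_univ] at this
  rw [this]
  refine Finset.sum_congr rfl fun N _ => ?_
  rw [← Complex.exp_sum]
  push_cast
  rw [Finset.sum_mul, Finset.sum_mul]

theorem Complex.norm_sum_exp_le {A : Type*} [Fintype A] (w : A → ℤ) (t : ℝ) :
    ‖∑ a, Complex.exp (w a * t * Complex.I)‖ ≤ Fintype.card A := by
  refine (norm_sum_le _ _).trans (le_of_eq ?_)
  have : ∀ a, ‖Complex.exp (w a * t * Complex.I)‖ = 1 := fun a => by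
    have := Complex.norm_exp_ofReal_mul_I (w a * t)
    simpa using this
  simp [this]

theorem Complex.norm_sum_exp_lt {A : Type*} [Fintype A] {w : A → ℤ} {a b : A} (t : ℝ)
    (h : Complex.exp (w a * t * Complex.I) ≠ Complex.exp (w b * t * Complex.I)) :
    ‖∑ a, Complex.exp (w a * t * Complex.I)‖ < Fintype.card A := by
  classical
  have hn : ∀ a, ‖Complex.exp (w a * t * Complex.I)‖ = 1 := fun a => by
    have := Complex.norm_exp_ofReal_mul_I (w a * t)
    simpa using this
  have hab : a ≠ b := by rintro rfl; exact h rfl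
  have h2 : ‖Complex.exp (w a * t * Complex.I) + Complex.exp (w b * t * Complex.I)‖ < 1 + 1 := by
    have := norm_add_lt_of_not_sameRay
      (x := Complex.exp (w a * t * Complex.I)) (y := Complex.exp (w b * t * Complex.I)) (by
        rw [sameRay_iff_of_norm_eq (by rw [hn, hn])]; exact h)
    rwa [hn, hn] at this
  rw [← Finset.sum_add_sum_compl {a, b}, Finset.sum_pair hab]
  have h3 : ‖∑ c ∈ ({a, b} : Finset A)ᶜ, Complex.exp (w c * t * Complex.I)‖ ≤
      (({a, b} : Finset A)ᶜ.card : ℝ) := by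
    refine (norm_sum_le _ _).trans ?_
    simp [hn]
  have h4 : (({a, b} : Finset A)ᶜ.card : ℝ) + 2 = Fintype.card A := by
    rw [← Finset.card_add_card_compl ({a, b} : Finset A), Finset.card_pair hab]
    push_cast; ring
  have := norm_add_le (Complex.exp (w a * t * Complex.I) + Complex.exp (w b * t * Complex.I))
    (∑ c ∈ ({a, b} : Finset A)ᶜ, Complex.exp (w c * t * Complex.I))
  linarith

open MeasureTheory in
/-- Two distinct characters of the circle agree at countably many points only. -/
theorem Complex.ae_exp_int_mul_ne {k l : ℤ} (h : k ≠ l) :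
    ∀ᵐ t : ℝ, Complex.exp (k * t * Complex.I) ≠ Complex.exp (l * t * Complex.I) := by
  have hsub : {t : ℝ | ¬ Complex.exp (k * t * Complex.I) ≠ Complex.exp (l * t * Complex.I)} ⊆
      Set.range fun m : ℤ => (m : ℝ) * (2 * Real.pi) / (k - l) := by
    intro t ht
    rw [Set.mem_ofPred_eq, not_not, Complex.exp_eq_exp_iff_exists_int] at ht
    obtain ⟨m, hm⟩ := ht
    refine ⟨m, ?_⟩
    have h0 : ((k : ℝ) - l) ≠ 0 := sub_ne_zero.2 (by exact_mod_cast h)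
    have : ((k : ℂ) * t) = l * t + m * (2 * Real.pi) := by
      apply mul_right_cancel₀ Complex.I_ne_zero
      rw [hm]; ring
    have : (k : ℝ) * t = l * t + m * (2 * Real.pi) := by exact_mod_cast this
    show (m : ℝ) * (2 * Real.pi) / (k - l) = t
    rw [div_eq_iff h0]; linarith
  exact measure_mono_null hsub ((Set.countable_range _).measure_zero _)

open MeasureTheory Filter Topology in
/-- **Anticoncentration**: let `w` be a nonconstant integer weight on a finite set `A`. The
largest proportion of words of length `n` over `A` with a prescribed total weight tends to `0`
with `n`. -/
theorem exists_forall_card_sum_weight_le {A : Type*} [Fintype A] (w : A → ℤ) {a b : A}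
    (hab : w a ≠ w b) {ε : ℝ} (hε : 0 < ε) :
    ∃ n₀ : ℕ, ∀ n ≥ n₀, ∀ v : ℤ,
      (Nat.card {N : Fin n → A // ∑ c, w (N c) = v} : ℝ) ≤ ε * (Fintype.card A : ℝ) ^ n := by
  classical
  have hA : (0 : ℝ) < Fintype.card A := by exact_mod_cast Fintype.card_pos_iff.2 ⟨a⟩
  set φ : ℝ → ℂ := fun t => (∑ a, Complex.exp (w a * t * Complex.I)) / Fintype.card A with hφ
  have hφc : Continuous φ := by fun_prop
  have hnorm : ∀ t, ‖φ t‖ = ‖∑ a, Complex.exp (w a * t * Complex.I)‖ / Fintype.card A := by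
    intro t; simp [hφ]
  have hlim := tendsto_integral_pow_zero (f := φ) (s := Set.Ioc 0 (2 * Real.pi)) 
    (by rw [Real.volume_Ioc]; exact ENNReal.ofReal_ne_top) hφc
    (fun t => by rw [hnorm, div_le_one hA]; exact Complex.norm_sum_exp_le w t)
    (by
      filter_upwards [Complex.ae_exp_int_mul_ne hab] with t ht
      rw [hnorm, div_lt_one hA]
      exact Complex.norm_sum_exp_lt t ht)
  obtain ⟨n₀, hn₀⟩ := eventually_atTop.1 ((tendsto_order.1 hlim).2 ε hε)
  refine ⟨n₀, fun n hn v => ?_⟩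
  -- The number of words of weight `v` is the `v`-th Fourier coefficient of the characteristic
  -- function.
  have key : ∫ t in (0 : ℝ)..2 * Real.pi,
      (∑ a, Complex.exp (w a * t * Complex.I)) ^ n * Complex.exp ((-v : ℤ) * t * Complex.I) =
      Nat.card {N : Fin n → A // ∑ c, w (N c) = v} * (2 * (Real.pi : ℂ)) := by
    have e : ∀ t : ℝ, (∑ a, Complex.exp (w a * t * Complex.I)) ^ n *
        Complex.exp ((-v : ℤ) * t * Complex.I) =
        ∑ N : Fin n → A, Complex.exp (((∑ c, w (N c)) - v : ℤ) * t * Complex.I) := by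
      intro t
      rw [Complex.sum_exp_pow, Finset.sum_mul]
      refine Finset.sum_congr rfl fun N _ => ?_
      rw [← Complex.exp_add]
      congr 1; push_cast; ring
    simp_rw [e]
    rw [intervalIntegral.integral_finsetSum
      (fun N _ => (Continuous.intervalIntegrable (by fun_prop) _ _))]
    simp_rw [Complex.integral_exp_int_mul_I, sub_eq_zero]
    rw [← Finset.sum_filter, Finset.sum_const, Nat.card_eq_fintype_card, Fintype.card_subtype,
      nsmul_eq_mul]
  have hpi := Real.pi_pos
  have hbound : (Nat.card {N : Fin n → A // ∑ c, w (N c) = v} : ℝ) * (2 * Real.pi) ≤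
      (Fintype.card A : ℝ) ^ n * ∫ t in Set.Ioc 0 (2 * Real.pi), ‖φ t‖ ^ n := by
    have h1 := congrArg norm key
    have h2 : ‖(Nat.card {N : Fin n → A // ∑ c, w (N c) = v} : ℂ) * (2 * (Real.pi : ℂ))‖ =
        (Nat.card {N : Fin n → A // ∑ c, w (N c) = v} : ℝ) * (2 * Real.pi) := by
      simp [abs_of_pos hpi]
    rw [h2] at h1
    rw [← h1, ← integral_const_mul]
    refine (intervalIntegral.norm_integral_le_integral_norm (by positivity)).trans (le_of_eq ?_)
    rw [intervalIntegral.integral_of_le (by positivity)]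
    congr 1
    funext t
    have hv : ‖Complex.exp ((-v : ℤ) * t * Complex.I)‖ = 1 := by
      have := Complex.norm_exp_ofReal_mul_I ((-v : ℤ) * t)
      simpa using this
    rw [norm_mul, norm_pow, hv, mul_one, hnorm, div_pow, mul_div_cancel₀ _ (by positivity)]
  have hlt := hn₀ n hn
  have h3 := hbound.trans (mul_le_mul_of_nonneg_left hlt.le (by positivity))
  have h1 : (1 : ℝ) ≤ 2 * Real.pi := by linarith [Real.pi_gt_three]
  calc (Nat.card {N : Fin n → A // ∑ c, w (N c) = v} : ℝ)
      ≤ (Nat.card {N : Fin n → A // ∑ c, w (N c) = v} : ℝ) * (2 * Real.pi) :=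
        le_mul_of_one_le_right (by positivity) h1
    _ ≤ _ := by rw [mul_comm ε]; exact h3

/-! ### Traces of powers and the determinant -/

theorem Matrix.card_roots_charpoly {K n : Type*} [Field K] [IsAlgClosed K] [Fintype n]
    [DecidableEq n] (A : Matrix n n K) : Multiset.card A.charpoly.roots = Fintype.card n := by
  rw [← (IsAlgClosed.splits A.charpoly).natDegree_eq_card_roots, A.charpoly_natDegree_eq_dim]

open Polynomial in
theorem Matrix.det_aeval_prod_X_sub_C {K n : Type*} [Field K] [IsAlgClosed K] [Fintype n]
    [DecidableEq n] (A : Matrix n n K) (s : Multiset K) :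
    (aeval A (s.map fun w => X - C w).prod).det =
      (A.charpoly.roots.map fun x => (s.map fun w => X - C w).prod.eval x).prod := by
  induction s using Multiset.induction_on with
  | empty => simp
  | cons w s ih =>
    have h1 : (aeval A (X - C w)).det = (A.charpoly.roots.map fun x => x - w).prod := by
      have h2 : A.charpoly.eval w = (A.charpoly.roots.map fun x => w - x).prod := by
        conv_lhs => rw [(IsAlgClosed.splits A.charpoly).eq_prod_roots_of_monic A.charpoly_monic]
        rw [eval_multiset_prod, Multiset.map_map]
        simp
      have h3 : aeval A (X - C w) = -(Matrix.scalar n w - A) := by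
        simp [Matrix.algebraMap_eq_diagonal, Matrix.scalar_apply]
      have h5 : (A.charpoly.roots.map fun x => x - w) =
          ((A.charpoly.roots.map fun x => w - x).map Neg.neg) := by
        rw [Multiset.map_map]; simp
      rw [h3, Matrix.det_neg, ← Matrix.eval_charpoly, h2, h5, Multiset.prod_map_neg,
        Multiset.card_map, A.card_roots_charpoly]
    rw [Multiset.map_cons, Multiset.prod_cons, map_mul, Matrix.det_mul, ih, h1,
      ← Multiset.prod_map_mul]
    simp

open Polynomial in
/-- Over an algebraically closed field, `det q(A)` is the product of the values of a monic
polynomial `q` at the eigenvalues of `A`, with multiplicity. -/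
theorem Matrix.det_aeval_of_monic {K n : Type*} [Field K] [IsAlgClosed K] [Fintype n]
    [DecidableEq n] (A : Matrix n n K) {q : K[X]} (hq : q.Monic) :
    (aeval A q).det = (A.charpoly.roots.map fun x => q.eval x).prod := by
  have h := (IsAlgClosed.splits q).eq_prod_roots_of_monic hq
  rw [h]
  exact A.det_aeval_prod_X_sub_C q.roots

open Polynomial in
/-- The value of `charpoly (A ^ k)` at `z` is, up to sign, `det q(A)` for `q = X ^ k - z`. -/
theorem Matrix.roots_charpoly_pow {K n : Type*} [Field K] [IsAlgClosed K] [Fintype n]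
    [DecidableEq n] (A : Matrix n n K) {k : ℕ} (hk : k ≠ 0) :
    (A ^ k).charpoly.roots = A.charpoly.roots.map (· ^ k) := by
  have h : (A ^ k).charpoly = ((A.charpoly.roots.map (· ^ k)).map fun w => X - C w).prod := by
    refine Polynomial.funext fun z => ?_
    have h1 := A.det_aeval_of_monic (monic_X_pow_sub_C z hk)
    have h3 : aeval A (X ^ k - C z) = -(Matrix.scalar n z - A ^ k) := by
      simp [Matrix.algebraMap_eq_diagonal, Matrix.scalar_apply]
    rw [h3, Matrix.det_neg, ← Matrix.eval_charpoly] at h1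
    have h5 : (A.charpoly.roots.map fun x => (X ^ k - C z).eval x) =
        ((A.charpoly.roots.map fun x => z - x ^ k).map Neg.neg) := by
      rw [Multiset.map_map]; simp
    rw [h5, Multiset.prod_map_neg, Multiset.card_map, A.card_roots_charpoly] at h1
    rw [mul_left_cancel₀ (pow_ne_zero _ (neg_ne_zero.2 one_ne_zero)) h1, eval_multiset_prod,
      Multiset.map_map, Multiset.map_map]
    simp
  rw [h, roots_multiset_prod_X_sub_C]

theorem Matrix.trace_pow_eq_sum_roots {K n : Type*} [Field K] [IsAlgClosed K] [Fintype n]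
    [DecidableEq n] (A : Matrix n n K) {k : ℕ} (hk : k ≠ 0) :
    (A ^ k).trace = (A.charpoly.roots.map (· ^ k)).sum := by
  rw [Matrix.trace_eq_sum_roots_charpoly, A.roots_charpoly_pow hk]

open MvPolynomial in
/-- In characteristic zero the power sums determine the elementary symmetric polynomials. -/
theorem MvPolynomial.aeval_esymm_eq_of_psum_eq {K σ : Type*} [Field K] [CharZero K] [Fintype σ]
    {x y : σ → K} (h : ∀ k ≠ 0, ∑ i, x i ^ k = ∑ i, y i ^ k) (k : ℕ) :
    aeval x (esymm σ K k) = aeval y (esymm σ K k) := by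
  induction k using Nat.strong_induction_on with
  | _ k ih =>
    rcases Nat.eq_zero_or_pos k with rfl | hk
    · simp
    have hp : ∀ j ≠ 0, aeval x (psum σ K j) = aeval y (psum σ K j) := by
      intro j hj
      simpa [psum] using h j hj
    have hx := congrArg (aeval x) (mul_esymm_eq_sum σ K k)
    have hy := congrArg (aeval y) (mul_esymm_eq_sum σ K k)
    have hk' : (k : K) ≠ 0 := by exact_mod_cast hk.ne'
    apply mul_left_cancel₀ hk'
    simp only [map_mul, map_natCast, map_pow, map_neg, map_one, map_sum] at hx hy
    rw [hx, hy]
    congr 1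
    refine Finset.sum_congr rfl fun a ha => ?_
    obtain ⟨ha1, ha2⟩ := Finset.mem_filter.1 ha
    have ha3 := Finset.HasAntidiagonal.mem_antidiagonal.1 ha1
    rw [ih a.1 ha2, hp a.2 (by omega)]

theorem Multiset.exists_eq_map_univ_fin {α : Type*} {k : ℕ} (s : Multiset α)
    (hs : Multiset.card s = k) : ∃ x : Fin k → α, s = Finset.univ.val.map x := by
  subst hs
  induction s using Quotient.inductionOn with
  | h L =>
    refine ⟨L.get, ?_⟩
    have := (Fin.univ_val_map L.get).symm
    rw [List.ofFn_get] at this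
    exact this

theorem Multiset.esymm_card_eq_prod {R : Type*} [CommSemiring R] {k : ℕ} (s : Multiset R)
    (hs : Multiset.card s = k) : s.esymm k = s.prod := by
  subst hs
  rw [Multiset.esymm, Multiset.powersetCard_self]
  simp

/-- Two complex matrices of the same size whose powers have the same traces have the same
determinant: by Newton's identities the power sums of the eigenvalues determine their product. -/
theorem Matrix.det_eq_of_trace_pow_eq {m n : Type*} [Fintype m] [DecidableEq m] [Fintype n]
    [DecidableEq n] (A : Matrix m m ℂ) (B : Matrix n n ℂ) (hc : Fintype.card m = Fintype.card n)
    (h : ∀ k ≠ 0, (A ^ k).trace = (B ^ k).trace) : A.det = B.det := by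
  obtain ⟨x, hx⟩ := A.charpoly.roots.exists_eq_map_univ_fin A.card_roots_charpoly
  obtain ⟨y, hy⟩ := B.charpoly.roots.exists_eq_map_univ_fin (B.card_roots_charpoly.trans hc.symm)
  have hp : ∀ k ≠ 0, ∑ i, x i ^ k = ∑ i, y i ^ k := by
    intro k hk
    have := h k hk
    rw [A.trace_pow_eq_sum_roots hk, B.trace_pow_eq_sum_roots hk, hx, hy, Multiset.map_map,
      Multiset.map_map] at this
    exact this
  have he := MvPolynomial.aeval_esymm_eq_of_psum_eq hp (Fintype.card m)
  rw [MvPolynomial.aeval_esymm_eq_multiset_esymm, MvPolynomial.aeval_esymm_eq_multiset_esymm,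
    Multiset.esymm_card_eq_prod _ (by simp), Multiset.esymm_card_eq_prod _ (by simp)] at he
  rw [A.det_eq_prod_roots_charpoly, B.det_eq_prod_roots_charpoly, hx, hy, he]

/-! ### Closed walks and traces -/

/-- Entries of a power of a matrix, as sums over walks. -/
theorem Matrix.pow_apply_eq_sum_walks {D R : Type*} [Fintype D] [DecidableEq D] [CommSemiring R]
    (M : Matrix D D R) (k : ℕ) (a b : D) :
    (M ^ k) a b = ∑ γ : Fin (k + 1) → D,
      if γ 0 = a ∧ γ (Fin.last k) = b then ∏ t : Fin k, M (γ t.castSucc) (γ t.succ) else 0 := by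
  induction k generalizing a with
  | zero =>
    rw [← (Equiv.funUnique (Fin 1) D).symm.sum_comp]
    simp only [pow_zero, Matrix.one_apply]
    simp [Finset.filter_and, Finset.filter_eq']
    split_ifs with h <;> simp [h]
  | succ k ih =>
    rw [pow_succ', Matrix.mul_apply, ← (Fin.consEquiv fun _ => D).sum_comp, Fintype.sum_prod_type]
    have h1 : ∀ x : D, (∑ γ : Fin (k + 1) → D,
        if Fin.consEquiv (fun _ => D) (x, γ) 0 = a ∧
          Fin.consEquiv (fun _ => D) (x, γ) (Fin.last (k + 1)) = b then
          ∏ t : Fin (k + 1), M (Fin.consEquiv (fun _ => D) (x, γ) t.castSucc)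
            (Fin.consEquiv (fun _ => D) (x, γ) t.succ) else 0) =
        if x = a then ∑ γ : Fin (k + 1) → D, if γ (Fin.last k) = b then
          M x (γ 0) * ∏ t : Fin k, M (γ t.castSucc) (γ t.succ) else 0 else 0 := by
      intro x
      by_cases hx : x = a
      · rw [if_pos hx]
        refine Finset.sum_congr rfl fun γ _ => ?_
        rw [Fin.prod_univ_succ]
        simp [Fin.consEquiv, hx, ← Fin.succ_last, ← Fin.succ_castSucc, -Fin.castSucc_succ]
      · rw [if_neg hx]
        refine Finset.sum_eq_zero fun γ _ => ?_
        rw [if_neg]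
        simp [Fin.consEquiv, hx]
    simp_rw [h1]
    rw [Finset.sum_ite_eq' Finset.univ a]
    simp only [Finset.mem_univ, if_true]
    simp_rw [ih, Finset.mul_sum]
    rw [Finset.sum_comm]
    refine Finset.sum_congr rfl fun γ _ => ?_
    by_cases hb : γ (Fin.last k) = b
    · simp [hb, mul_ite]
    · simp [hb]

/-- The trace of the `ℓ`-th power of the zero-one matrix of a relation counts its closed walks of
length `ℓ`. -/
theorem Matrix.trace_pow_of_relation {D : Type*} [Fintype D] [DecidableEq D] (r : D → D → Prop)
    [DecidableRel r] {ℓ : ℕ} (hℓ : ℓ ≠ 0) :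
    ((Matrix.of fun a b => if r a b then (1 : ℂ) else 0) ^ ℓ).trace =
      Nat.card {γ : ZMod ℓ → D // ∀ i, r (γ i) (γ (i + 1))} := by
  classical
  obtain ⟨k, rfl⟩ := Nat.exists_eq_succ_of_ne_zero hℓ
  set M : Matrix D D ℂ := Matrix.of fun a b => if r a b then (1 : ℂ) else 0 with hM
  have h1 : (M ^ (k + 1)).trace = ∑ γ : Fin (k + 1) → D,
      (∏ t : Fin k, M (γ t.castSucc) (γ t.succ)) * M (γ (Fin.last k)) (γ 0) := by
    rw [pow_succ, Matrix.trace]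
    simp only [Matrix.diag_apply, Matrix.mul_apply, Matrix.pow_apply_eq_sum_walks, Finset.sum_mul]
    rw [Finset.sum_congr rfl fun a _ => Finset.sum_comm, Finset.sum_comm]
    refine Finset.sum_congr rfl fun γ _ => ?_
    rw [Finset.sum_eq_single (γ 0), Finset.sum_eq_single (γ (Fin.last k))]
    · simp
    · intro b _ hb; simp [hb.symm]
    · simp
    · intro b _ hb; simp [hb.symm]
    · simp
  have h2 : ∀ γ : Fin (k + 1) → D,
      (∏ t : Fin k, M (γ t.castSucc) (γ t.succ)) * M (γ (Fin.last k)) (γ 0) =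
        if ∀ i, r (γ i) (γ (i + 1)) then 1 else 0 := by
    intro γ
    have : (∏ t : Fin k, M (γ t.castSucc) (γ t.succ)) * M (γ (Fin.last k)) (γ 0) =
        ∏ i : Fin (k + 1), M (γ i) (γ (i + 1)) := by
      rw [Fin.prod_univ_castSucc]
      simp
    rw [this]
    simp only [hM, Matrix.of_apply]
    rw [Finset.prod_boole]
    simp
  rw [h1, Finset.sum_congr rfl fun γ _ => h2 γ, Finset.sum_boole]
  rw [← Fintype.card_subtype, ← Nat.card_eq_fintype_card]
  rfl

/-! ### Closed geodesics as periodic sequences -/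

/-- The left shift on sequences. -/
def seqShift {D : Type*} (x : ℕ → D) : ℕ → D := fun i => x (i + 1)

theorem seqShift_iterate {D : Type*} (n : ℕ) (x : ℕ → D) (i : ℕ) :
    seqShift^[n] x i = x (i + n) := by
  induction n generalizing x with
  | zero => rfl
  | succ n ih => rw [Function.iterate_succ_apply, ih, seqShift]; congr 1

/-- The periodic sequence unrolling a cyclic word. -/
def unroll {D : Type*} {ℓ : ℕ} (γ : ZMod ℓ → D) : ℕ → D := fun i => γ i

theorem isPeriodicPt_unroll {D : Type*} {ℓ : ℕ} (γ : ZMod ℓ → D) :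
    Function.IsPeriodicPt seqShift ℓ (unroll γ) := by
  funext i
  rw [seqShift_iterate]
  simp [unroll]

theorem unroll_injective {D : Type*} {ℓ : ℕ} [NeZero ℓ] :
    Function.Injective (unroll : (ZMod ℓ → D) → ℕ → D) := by
  intro γ γ' h
  funext i
  have := congrFun h i.val
  simpa [unroll] using this

theorem exists_unroll_eq {D : Type*} {ℓ : ℕ} {x : ℕ → D}
    (hx : Function.IsPeriodicPt seqShift ℓ x) : ∃ γ : ZMod ℓ → D, unroll γ = x := by
  rcases Nat.eq_zero_or_pos ℓ with rfl | hℓ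
  · refine ⟨fun i => x (Int.natAbs i), ?_⟩
    funext i
    rfl
  · have : NeZero ℓ := ⟨hℓ.ne'⟩
    refine ⟨fun i => x i.val, ?_⟩
    funext i
    show x ((i : ZMod ℓ)).val = x i
    rw [ZMod.val_natCast]
    have h := congrFun (hx.iterate_mod_apply i) 0
    rw [seqShift_iterate, seqShift_iterate] at h
    simpa using h

theorem unroll_add {D : Type*} {ℓ : ℕ} (γ : ZMod ℓ → D) (s : ℕ) :
    unroll (fun i : ZMod ℓ => γ (i + (s : ZMod ℓ))) = seqShift^[s] (unroll γ) := by
  funext i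
  rw [seqShift_iterate]
  simp [unroll]

theorem unroll_castHom {D : Type*} {ℓ d : ℕ} (h : d ∣ ℓ) (δ : ZMod d → D) :
    unroll (fun i => δ (ZMod.castHom h (ZMod d) i)) = unroll δ := by
  funext i
  simp [unroll]

namespace SimpleGraph

variable {V : Type*} (G : SimpleGraph V)

/-- The relation "`e` may be followed by `e'`" on oriented edges: `e'` starts where `e` ends and is
not the inverse of `e`. -/
def NonBacktracking (e e' : G.Dart) : Prop := e.snd = e'.fst ∧ e ≠ e'.symm

/-- Closed geodesics of length `ℓ ≥ 1` are the sequences of period `ℓ` in the subshift of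
non-backtracking walks. -/
theorem isClosedGeodesic_iff_unroll {ℓ : ℕ} [NeZero ℓ] (γ : ZMod ℓ → G.Dart) :
    G.IsClosedGeodesic γ ↔ ∀ n, G.NonBacktracking (unroll γ n) (unroll γ (n + 1)) := by
  constructor
  · intro h n
    have := h n
    simpa [unroll, NonBacktracking] using this
  · intro h i
    have := h i.val
    simpa [unroll, NonBacktracking] using this

/-- A closed geodesic is primitive if and only if its length is the least period of its
unrolling. -/
theorem isPrimitiveClosedGeodesic_iff {ℓ : ℕ} [NeZero ℓ] (γ : ZMod ℓ → G.Dart) :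
    G.IsPrimitiveClosedGeodesic γ ↔
      G.IsClosedGeodesic γ ∧ Function.minimalPeriod seqShift (unroll γ) = ℓ := by
  have hℓ : 0 < ℓ := Nat.pos_of_ne_zero (NeZero.ne ℓ)
  refine and_congr_right fun hγ => ⟨fun h => ?_, ?_⟩
  · by_contra hne
    apply h
    -- If the least period `d` is smaller than `ℓ`, then `γ` is a multiple of its first `d` edges.
    have hdvd := (isPeriodicPt_unroll γ).minimalPeriod_dvd
    have hpos := (isPeriodicPt_unroll γ).minimalPeriod_pos hℓ
    set d := Function.minimalPeriod seqShift (unroll γ) with hd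
    obtain ⟨k, hk⟩ := hdvd
    have : NeZero d := ⟨hpos.ne'⟩
    obtain ⟨δ, hδ⟩ := exists_unroll_eq (Function.isPeriodicPt_minimalPeriod seqShift (unroll γ))
    refine ⟨k, d, by rw [hk, mul_comm], δ, ?_, ?_, ?_⟩
    · rcases k with _ | _ | k
      · omega
      · omega
      · omega
    · rw [isClosedGeodesic_iff_unroll]
      rw [isClosedGeodesic_iff_unroll] at hγ
      intro n
      have := hγ n
      rwa [← hδ] at this
    · refine congrFun (unroll_injective ?_)
      rw [unroll_castHom]
      exact hδ.symm
  · rintro h ⟨k, d, hkd, δ, hk, -, hδ⟩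
    have he : unroll γ = unroll δ := by
      rw [← unroll_castHom (Dvd.intro_left k hkd.symm) δ]
      congr 1
      exact funext hδ
    have hdvd := (isPeriodicPt_unroll δ).minimalPeriod_dvd
    rw [← he, h] at hdvd
    have hd : 0 < d := Nat.pos_of_ne_zero (by rintro rfl; omega)
    have := Nat.le_of_dvd hd hdvd
    nlinarith

theorem numPrimitiveGeodesics_one : G.numPrimitiveGeodesics 1 = 0 := by
  have : IsEmpty {γ : ZMod 1 → G.Dart // G.IsPrimitiveClosedGeodesic γ} := by
    refine ⟨fun γ => ?_⟩
    have h := (γ.2.1 0).1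
    rw [Subsingleton.elim (0 + 1 : ZMod 1) 0] at h
    exact (γ.1 0).snd_ne_fst h
  rw [numPrimitiveGeodesics, Nat.card_eq_zero]
  exact Or.inl (Quotient.instIsEmpty)

theorem numPrimitiveGeodesics_two : G.numPrimitiveGeodesics 2 = 0 := by
  have : IsEmpty {γ : ZMod 2 → G.Dart // G.IsPrimitiveClosedGeodesic γ} := by
    refine ⟨fun γ => ?_⟩
    obtain ⟨h, hne⟩ := γ.2.1 0
    have h' := (γ.2.1 1).1
    rw [show (1 + 1 : ZMod 2) = 0 from rfl] at h'
    rw [zero_add] at h hne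
    exact hne (Dart.ext _ _ (Prod.ext h'.symm h))
  rw [numPrimitiveGeodesics, Nat.card_eq_zero]
  exact Or.inl (Quotient.instIsEmpty)

theorem IsPrimitiveClosedGeodesic.shift {ℓ : ℕ} [NeZero ℓ] {γ : ZMod ℓ → G.Dart}
    (h : G.IsPrimitiveClosedGeodesic γ) (s : ZMod ℓ) :
    G.IsPrimitiveClosedGeodesic fun i => γ (i + s) := by
  rw [isPrimitiveClosedGeodesic_iff] at h ⊢
  refine ⟨fun i => ?_, ?_⟩
  · have := h.1 (i + s)
    rwa [add_right_comm] at this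
  · have hs : (fun i => γ (i + s)) = fun i => γ (i + (s.val : ZMod ℓ)) := by simp
    rw [hs, unroll_add, Function.minimalPeriod_apply_iterate, h.2]
    exact Function.mk_mem_periodicPts (Nat.pos_of_ne_zero (NeZero.ne ℓ)) (isPeriodicPt_unroll γ)

/-- The cyclic shifts of a primitive closed geodesic are pairwise distinct. -/
theorem IsPrimitiveClosedGeodesic.shift_injective {ℓ : ℕ} [NeZero ℓ] {γ : ZMod ℓ → G.Dart}
    (h : G.IsPrimitiveClosedGeodesic γ) {s t : ZMod ℓ} (hst : ∀ i, γ (i + s) = γ (i + t)) :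
    s = t := by
  rw [isPrimitiveClosedGeodesic_iff] at h
  have h1 : ∀ i, γ (i + (s - t)) = γ i := by
    intro i
    have := hst (i - t)
    rwa [sub_add_cancel, sub_add_eq_add_sub, ← add_sub_assoc'] at this
  have h2 : Function.IsPeriodicPt seqShift (s - t).val (unroll γ) := by
    have : (fun i => γ (i + ((s - t).val : ZMod ℓ))) = γ := by
      funext i
      simpa using h1 i
    have h3 := unroll_add γ (s - t).val
    rw [this] at h3
    exact h3.symm
  have h3 := h2.minimalPeriod_dvd
  rw [h.2] at h3
  have h4 := Nat.eq_zero_of_dvd_of_lt h3 (ZMod.val_lt _)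
  rw [ZMod.val_eq_zero] at h4
  exact sub_eq_zero.1 h4

variable [Finite V]

theorem finite_dart : Finite G.Dart :=
  Finite.of_injective _ Dart.toProd_injective

/-- The cyclic group of order `ℓ` acts freely on the primitive closed geodesics of length `ℓ`. -/
theorem card_primitiveClosedGeodesics {ℓ : ℕ} [NeZero ℓ] :
    Nat.card {γ : ZMod ℓ → G.Dart // G.IsPrimitiveClosedGeodesic γ} =
      ℓ * G.numPrimitiveGeodesics ℓ := by
  classical
  have := G.finite_dart
  have : Fintype (ZMod ℓ) := ZMod.fintype ℓ
  have : Finite (ZMod ℓ → G.Dart) := Pi.finite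
  let _ : Fintype (Quotient (G.primitiveGeodesicSetoid ℓ)) := Fintype.ofFinite _
  rw [← Nat.card_congr (Equiv.sigmaFiberEquiv
    (Quotient.mk (G.primitiveGeodesicSetoid ℓ))), Nat.card_sigma]
  have hfib : ∀ q : Quotient (G.primitiveGeodesicSetoid ℓ),
      Nat.card {γ // Quotient.mk (G.primitiveGeodesicSetoid ℓ) γ = q} = ℓ := by
    intro q
    obtain ⟨γ, rfl⟩ := Quotient.exists_rep q
    have hb : Function.Bijective (fun s : ZMod ℓ =>
        (⟨⟨fun i => γ.1 (i + s), γ.2.shift G s⟩,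
          Quotient.sound ⟨-s, fun i => by simp⟩⟩ :
        {γ' // Quotient.mk (G.primitiveGeodesicSetoid ℓ) γ' =
          Quotient.mk (G.primitiveGeodesicSetoid ℓ) γ})) := by
      constructor
      · intro s t hst
        have := congrArg (fun x => x.1.1) hst
        exact γ.2.shift_injective G (congrFun this)
      · rintro ⟨γ', h⟩
        obtain ⟨s, hs⟩ := Quotient.exact h.symm
        exact ⟨s, Subtype.ext (Subtype.ext (funext fun i => (hs i).symm))⟩
    rw [← Nat.card_eq_of_bijective _ hb, Nat.card_zmod]
  rw [Finset.sum_congr rfl fun q _ => hfib q, Finset.sum_const, Finset.card_univ,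
    ← Nat.card_eq_fintype_card, smul_eq_mul, mul_comm]
  rfl

/-- Every closed geodesic is a multiple of a unique primitive one, whose length is the least
period. -/
theorem card_closedGeodesics {ℓ : ℕ} (hℓ : ℓ ≠ 0) :
    Nat.card {γ : ZMod ℓ → G.Dart // G.IsClosedGeodesic γ} =
      ∑ d ∈ ℓ.divisors, d * G.numPrimitiveGeodesics d := by
  classical
  have := G.finite_dart
  have : NeZero ℓ := ⟨hℓ⟩
  have : Fintype (ZMod ℓ) := ZMod.fintype ℓ
  let p : {γ : ZMod ℓ → G.Dart // G.IsClosedGeodesic γ} → ℓ.divisors := fun γ =>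
    ⟨Function.minimalPeriod seqShift (unroll γ.1),
      Nat.mem_divisors.2 ⟨(isPeriodicPt_unroll γ.1).minimalPeriod_dvd, hℓ⟩⟩
  rw [← Nat.card_congr (Equiv.sigmaFiberEquiv p), Nat.card_sigma,
    ← Finset.sum_coe_sort ℓ.divisors fun d => d * G.numPrimitiveGeodesics d]
  refine Finset.sum_congr rfl fun d _ => ?_
  obtain ⟨d, hd⟩ := d
  have hdvd := (Nat.mem_divisors.1 hd).1
  have : NeZero d := ⟨(Nat.pos_of_mem_divisors hd).ne'⟩
  rw [← card_primitiveClosedGeodesics]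
  have hcl : ∀ δ : ZMod d → G.Dart, G.IsClosedGeodesic δ →
      G.IsClosedGeodesic fun i => δ (ZMod.castHom hdvd (ZMod d) i) := by
    intro δ hδ
    rw [isClosedGeodesic_iff_unroll] at hδ ⊢
    rwa [unroll_castHom]
  refine (Nat.card_eq_of_bijective (fun δ :
    {γ : ZMod d → G.Dart // G.IsPrimitiveClosedGeodesic γ} =>
    (⟨⟨fun i => δ.1 (ZMod.castHom hdvd (ZMod d) i), hcl δ.1 δ.2.1⟩, Subtype.ext (by
      show Function.minimalPeriod seqShift (unroll fun i => δ.1 _) = d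
      rw [unroll_castHom, ((G.isPrimitiveClosedGeodesic_iff δ.1).1 δ.2).2])⟩ :
      {γ // p γ = ⟨d, hd⟩})) ⟨?_, ?_⟩).symm
  · intro δ δ' h
    have h1 := congrArg (fun x => unroll x.1.1) h
    simp only [unroll_castHom] at h1
    exact Subtype.ext (unroll_injective h1)
  · rintro ⟨γ, hγ⟩
    have hγ' : Function.minimalPeriod seqShift (unroll γ.1) = d := congrArg Subtype.val hγ
    have hper := Function.isPeriodicPt_minimalPeriod seqShift (unroll γ.1)
    rw [hγ'] at hper
    obtain ⟨δ, hδ⟩ := exists_unroll_eq hper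
    have hδc : G.IsClosedGeodesic δ := by
      rw [isClosedGeodesic_iff_unroll, hδ, ← isClosedGeodesic_iff_unroll]
      exact γ.2
    refine ⟨⟨δ, (G.isPrimitiveClosedGeodesic_iff δ).2 ⟨hδc, by rw [hδ, hγ']⟩⟩,
      Subtype.ext (Subtype.ext (unroll_injective ?_))⟩
    exact (unroll_castHom hdvd δ).trans hδ

end SimpleGraph

/-! ### Coefficients of the zeta function -/

namespace PowerSeries

theorem constantCoeff_inv_one_sub_X_pow_pow {ℓ : ℕ} (hℓ : ℓ ≠ 0) (a : ℕ) :
    constantCoeff (((1 - (X : PowerSeries ℂ) ^ ℓ)⁻¹) ^ a) = 1 := by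
  simp [hℓ]

/-- `(1 - t ^ ℓ) ^ (-a) ≡ 1 + a t ^ ℓ` modulo higher powers of `t`. -/
theorem inv_one_sub_X_pow_pow_eq {ℓ : ℕ} (hℓ : ℓ ≠ 0) (a : ℕ) :
    ∃ q : PowerSeries ℂ,
      ((1 - (X : PowerSeries ℂ) ^ ℓ)⁻¹) ^ a =
        1 + (a : PowerSeries ℂ) * X ^ ℓ + X ^ (ℓ + 1) * q := by
  have hc : constantCoeff (1 - (X : PowerSeries ℂ) ^ ℓ) ≠ 0 := by simp [hℓ]
  have hm := PowerSeries.mul_inv_cancel _ hc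
  obtain ⟨j, rfl⟩ := Nat.exists_eq_add_one_of_ne_zero hℓ
  induction a with
  | zero => exact ⟨0, by simp⟩
  | succ a ih =>
    obtain ⟨q, hq⟩ := ih
    rw [pow_succ, hq]
    set u := (1 - (X : PowerSeries ℂ) ^ (j + 1))⁻¹ with hu
    -- `u = 1 + X ^ ℓ + X ^ (2ℓ) u`
    have h2 : u = 1 + X ^ (j + 1) + X ^ (j + 1) * X ^ (j + 1) * u := by
      linear_combination (1 + (X : PowerSeries ℂ) ^ (j + 1)) * hm
    refine ⟨q * u + (a : PowerSeries ℂ) * X ^ j * u + X ^ j * u, ?_⟩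
    push_cast
    linear_combination h2 + (a : PowerSeries ℂ) * X ^ (j + 1) * hm

end PowerSeries

namespace SimpleGraph

theorem constantCoeff_iharaPartialProduct {V : Type*} (G : SimpleGraph V) (M : ℕ) :
    PowerSeries.constantCoeff (G.iharaPartialProduct M) = 1 := by
  rw [iharaPartialProduct, map_prod]
  refine Finset.prod_eq_one fun ℓ hℓ => ?_
  rw [Finset.mem_Icc] at hℓ
  exact PowerSeries.constantCoeff_inv_one_sub_X_pow_pow (by omega) _

/-- The first coefficient of the zeta function that involves `a(ℓ + 1)` is that of `t ^ (ℓ + 1)`. -/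
theorem coeff_iharaZeta_succ {V : Type*} (G : SimpleGraph V) {ℓ : ℕ} (hℓ : 3 ≤ ℓ + 1) :
    PowerSeries.coeff (ℓ + 1) G.iharaZeta =
      PowerSeries.coeff (ℓ + 1) (G.iharaPartialProduct ℓ) + G.numPrimitiveGeodesics (ℓ + 1) := by
  rw [← G.coeff_iharaPartialProduct le_rfl, iharaPartialProduct, Finset.prod_Icc_succ_top hℓ,
    ← iharaPartialProduct]
  obtain ⟨q, hq⟩ := PowerSeries.inv_one_sub_X_pow_pow_eq (Nat.succ_ne_zero ℓ)
    (G.numPrimitiveGeodesics (ℓ + 1))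
  rw [hq]
  have e : G.iharaPartialProduct ℓ *
      (1 + (G.numPrimitiveGeodesics (ℓ + 1) : PowerSeries ℂ) * PowerSeries.X ^ (ℓ + 1) +
        PowerSeries.X ^ (ℓ + 1 + 1) * q) =
      G.iharaPartialProduct ℓ + PowerSeries.X ^ (ℓ + 1) *
        (PowerSeries.C (G.numPrimitiveGeodesics (ℓ + 1) : ℂ) * G.iharaPartialProduct ℓ) +
        PowerSeries.X ^ (ℓ + 1 + 1) * (q * G.iharaPartialProduct ℓ) := by
    rw [map_natCast]
    ring
  rw [e, map_add, map_add, PowerSeries.coeff_X_pow_mul', PowerSeries.coeff_X_pow_mul',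
    if_pos le_rfl, if_neg (by omega), add_zero, Nat.sub_self,
    PowerSeries.coeff_zero_eq_constantCoeff, map_mul, constantCoeff_iharaPartialProduct, mul_one, PowerSeries.constantCoeff_C]

theorem numPrimitiveGeodesics_eq_of_iharaZeta_eq {V W : Type*} {G : SimpleGraph V}
    {H : SimpleGraph W} (h : G.iharaZeta = H.iharaZeta) {ℓ : ℕ} (hℓ : ℓ ≠ 0) :
    G.numPrimitiveGeodesics ℓ = H.numPrimitiveGeodesics ℓ := by
  induction ℓ using Nat.strong_induction_on with
  | _ ℓ ih =>
    obtain ⟨k, rfl⟩ := Nat.exists_eq_add_one_of_ne_zero hℓ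
    rcases k with _ | _ | k
    · rw [numPrimitiveGeodesics_one, numPrimitiveGeodesics_one]
    · rw [numPrimitiveGeodesics_two, numPrimitiveGeodesics_two]
    · have hp : G.iharaPartialProduct (k + 2) = H.iharaPartialProduct (k + 2) := by
        rw [iharaPartialProduct, iharaPartialProduct]
        refine Finset.prod_congr rfl fun ℓ hℓ => ?_
        rw [Finset.mem_Icc] at hℓ
        rw [ih ℓ (by omega) (by omega)]
      have hG := G.coeff_iharaZeta_succ (ℓ := k + 2) (by omega)
      have hH := H.coeff_iharaZeta_succ (ℓ := k + 2) (by omega)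
      rw [h, hp, hH] at hG
      exact_mod_cast (add_left_cancel hG).symm

/-! ### The edge matrix -/

open Classical in
/-- The non-backtracking matrix of Hashimoto, indexed by the oriented edges. -/
noncomputable def edgeMatrix {V : Type*} (G : SimpleGraph V) : Matrix G.Dart G.Dart ℂ :=
  Matrix.of fun e e' => if G.NonBacktracking e e' then 1 else 0

open Classical in
/-- Ihara's theorem in the form needed here: the zeta function determines the traces of the powers
of the edge matrix, hence its determinant. -/
theorem det_edgeMatrix_eq_of_iharaZeta_eq {V W : Type*} [Fintype V] [Fintype W]
    {G : SimpleGraph V} {H : SimpleGraph W} (h : G.iharaZeta = H.iharaZeta)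
    (hc : Fintype.card G.Dart = Fintype.card H.Dart) :
    G.edgeMatrix.det = H.edgeMatrix.det := by
  refine Matrix.det_eq_of_trace_pow_eq _ _ hc fun k hk => ?_
  rw [edgeMatrix, edgeMatrix, Matrix.trace_pow_of_relation _ hk, Matrix.trace_pow_of_relation _ hk]
  have hG := G.card_closedGeodesics hk
  have hH := H.card_closedGeodesics hk
  rw [Finset.sum_congr rfl fun d hd => by
    rw [numPrimitiveGeodesics_eq_of_iharaZeta_eq h (Nat.pos_of_mem_divisors hd).ne'], ← hH] at hG
  exact congrArg Nat.cast hG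

end SimpleGraph

theorem Matrix.det_ones_sub_one {R m : Type*} [CommRing R] [Fintype m] [DecidableEq m] :
    (Matrix.of fun a b : m => if a ≠ b then (1 : R) else 0).det =
      (-1) ^ Fintype.card m * (1 - Fintype.card m) := by
  have h : (Matrix.of fun a b : m => if a ≠ b then (1 : R) else 0) =
      -((1 : Matrix m m R) +
        Matrix.replicateCol Unit (fun _ : m => (-1 : R)) *
          Matrix.replicateRow Unit fun _ : m => (1 : R)) := by
    ext a b
    simp [Matrix.mul_apply, Matrix.one_apply]
    split_ifs <;> simp
  rw [h, Matrix.det_neg, Matrix.det_one_add_replicateCol_mul_replicateRow]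
  simp [dotProduct, sub_eq_add_neg]

/-- The determinant of a matrix that vanishes off the diagonal blocks given by the fibres of
a map to an index type without a preferred order. -/
theorem Matrix.det_eq_prod_det_toSquareBlock {R m α : Type*} [CommRing R] [Fintype m]
    [DecidableEq m] [Fintype α] [DecidableEq α] {M : Matrix m m R} {b : m → α}
    (h : ∀ i j, b i ≠ b j → M i j = 0) : M.det = ∏ k, (M.toSquareBlock b k).det := by
  let _ : LinearOrder α :=
    LinearOrder.lift' (Fintype.equivFin α) (Fintype.equivFin α).injective
  have hbt : M.BlockTriangular b := fun i j hij => h i j hij.ne'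
  exact hbt.det_fintype

namespace SimpleGraph

open Classical in
theorem sign_dart_symm {V : Type*} [Fintype V] (G : SimpleGraph V) :
    Equiv.Perm.sign (Dart.symm_involutive (G := G)).toPerm =
      (-1) ^ (Fintype.card G.Dart / 2) := by
  have h2 : (Dart.symm_involutive (G := G)).toPerm ^ 2 = 1 := by
    ext1 e
    simp [pow_two]
  rw [Equiv.Perm.sign_of_cycleType_eq_replicate two_pos
    (Equiv.Perm.cycleType_of_pow_prime_eq_one h2)]
  have : IsEmpty (Function.fixedPoints (Dart.symm_involutive (G := G)).toPerm) :=
    ⟨fun e => e.1.symm_ne e.2⟩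
  rw [if_neg (by decide), Fintype.card_eq_zero (α := Function.fixedPoints _), Nat.sub_zero]

open Classical in
/-- Up to reversing the edges that index its rows, the edge matrix is block diagonal with respect to
the initial vertices, with a block `J - 1` of size `deg v` for each vertex `v`. -/
theorem det_edgeMatrix {V : Type*} [Fintype V] (G : SimpleGraph V) :
    G.edgeMatrix.det = (-1) ^ (Fintype.card G.Dart / 2) * ∏ v, (1 - (G.degree v : ℂ)) := by
  set M : Matrix G.Dart G.Dart ℂ :=
    Matrix.of fun e e' => if e.fst = e'.fst ∧ e ≠ e' then 1 else 0 with hM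
  have h1 : G.edgeMatrix = M.submatrix (Dart.symm_involutive (G := G)).toPerm id := by
    ext e e'
    have : e ≠ e'.symm ↔ e.symm ≠ e' := by
      rw [not_iff_not]
      exact ⟨fun h => by rw [h, Dart.symm_symm], fun h => by rw [← h, Dart.symm_symm]⟩
    exact if_congr (and_congr_right fun _ => this) rfl rfl
  rw [h1, Matrix.det_permute, sign_dart_symm]
  push_cast
  congr 1
  rw [Matrix.det_eq_prod_det_toSquareBlock (M := M) (b := fun e => e.fst) fun e e' hne => by
    rw [hM, Matrix.of_apply, if_neg fun h => hne h.1]]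
  have hcard : ∀ v, Fintype.card {e : G.Dart // e.fst = v} = G.degree v := by
    intro v
    rw [← G.dart_fst_fiber_card_eq_degree v, Fintype.card_subtype]
  have hblock : ∀ v, (M.toSquareBlock (fun e => e.fst) v).det =
      (-1) ^ G.degree v * (1 - (G.degree v : ℂ)) := by
    intro v
    rw [← hcard v, ← Matrix.det_ones_sub_one]
    congr 1
    ext a b
    simp only [Matrix.toSquareBlock_def, hM, Matrix.of_apply]
    refine if_congr ?_ rfl rfl
    rw [a.2, b.2, ne_eq, ne_eq, Subtype.ext_iff]
    simp
  rw [Finset.prod_congr rfl fun v _ => hblock v, Finset.prod_mul_distrib,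
    Finset.prod_pow_eq_pow_sum, ← dart_card_eq_sum_degrees, dart_card_eq_twice_card_edges, pow_mul]
  simp

open Classical in
/-- The zeta function and the number of edges determine the product of the numbers
`1 - deg v`. -/
theorem prod_one_sub_degree_eq_of_iharaZeta_eq {V W : Type*} [Fintype V] [Fintype W]
    {G : SimpleGraph V} {H : SimpleGraph W} (h : G.iharaZeta = H.iharaZeta)
    (hc : ∑ v, G.degree v = ∑ v, H.degree v) :
    ∏ v, (1 - (G.degree v : ℤ)) = ∏ v, (1 - (H.degree v : ℤ)) := by
  rw [← dart_card_eq_sum_degrees, ← dart_card_eq_sum_degrees] at hc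
  have hd := det_edgeMatrix_eq_of_iharaZeta_eq h hc
  rw [det_edgeMatrix, det_edgeMatrix, hc] at hd
  have := mul_left_cancel₀ (pow_ne_zero _ (neg_ne_zero.2 one_ne_zero)) hd
  exact_mod_cast this

end SimpleGraph

/-! ### Degrees of cones and of switched graphs -/

namespace SimpleGraph

open Classical in
theorem degree_eq_sum_ite {V : Type*} [Fintype V] (G : SimpleGraph V) (v : V)
    [Fintype (G.neighborSet v)] : (G.degree v : ℤ) = ∑ w, if G.Adj v w then 1 else 0 := by
  rw [Finset.sum_boole, ← card_neighborFinset_eq_degree]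
  congr 2
  ext w
  simp

open Classical in
theorem degree_cone_inl {V : Type*} [Fintype V] (G : SimpleGraph V) (v : V)
    [Fintype (G.neighborSet v)] [Fintype (G.cone.neighborSet (Sum.inl v))] :
    (G.cone.degree (Sum.inl v) : ℤ) = G.degree v + 1 := by
  rw [degree_eq_sum_ite, degree_eq_sum_ite, Fintype.sum_sum_type]
  simp [cone, joinGraph]

open Classical in
theorem degree_cone_inr {V : Type*} [Fintype V] (G : SimpleGraph V)
    [Fintype (G.cone.neighborSet (Sum.inr ()))] :
    (G.cone.degree (Sum.inr ()) : ℤ) = Fintype.card V := by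
  rw [degree_eq_sum_ite, Fintype.sum_sum_type]
  simp [cone, joinGraph]

end SimpleGraph

namespace GMSwitching

/-- The number of ones in the row `b` of `N`, as an integer. -/
def rowOnes {β γ : Type*} [Fintype γ] (N : Matrix β γ Bool) (b : β) : ℤ :=
  ∑ c, (N b c).toNat

theorem colOnes_eq_sum {β γ : Type*} [Fintype β] (N : Matrix β γ Bool) (c : γ) :
    (colOnes N c : ℤ) = ∑ b, ((N b c).toNat : ℤ) := by
  rw [colOnes, Finset.card_filter]
  push_cast
  refine Finset.sum_congr rfl fun b _ => ?_
  cases N b c <;> rfl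

open Classical in
theorem degree_blockGraph_inl {β γ : Type*} [Fintype β] [Fintype γ] (GB : SimpleGraph β)
    (GC : SimpleGraph γ) (N : Matrix β γ Bool) (b : β)
    [Fintype (GB.neighborSet b)] [Fintype ((blockGraph GB GC N).neighborSet (Sum.inl b))] :
    ((blockGraph GB GC N).degree (Sum.inl b) : ℤ) = GB.degree b + rowOnes N b := by
  rw [SimpleGraph.degree_eq_sum_ite, SimpleGraph.degree_eq_sum_ite, Fintype.sum_sum_type, rowOnes]
  refine congrArg₂ _ rfl (Finset.sum_congr rfl fun c _ => ?_)
  by_cases h : N b c = true <;> simp [blockGraph, h]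

open Classical in
theorem degree_blockGraph_inr {β γ : Type*} [Fintype β] [Fintype γ] (GB : SimpleGraph β)
    (GC : SimpleGraph γ) (N : Matrix β γ Bool) (c : γ)
    [Fintype (GC.neighborSet c)] [Fintype ((blockGraph GB GC N).neighborSet (Sum.inr c))] :
    ((blockGraph GB GC N).degree (Sum.inr c) : ℤ) = colOnes N c + GC.degree c := by
  rw [SimpleGraph.degree_eq_sum_ite, SimpleGraph.degree_eq_sum_ite, Fintype.sum_sum_type,
    colOnes_eq_sum]
  refine congrArg₂ _ (Finset.sum_congr rfl fun b _ => ?_) rfl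
  by_cases h : N b c = true <;> simp [blockGraph, h]

/-- Superposing an admissible matrix with its switch gives constant columns. -/
theorem card_mul_add_switchMatrix {β γ : Type*} [Fintype β] {N : Matrix β γ Bool}
    (hN : Admissible N) (b : β) (c : γ) :
    (Fintype.card β : ℤ) * ((N b c).toNat + (switchMatrix N b c).toNat) = 2 * colOnes N c := by
  by_cases hh : 2 * colOnes N c = Fintype.card β
  · have : switchMatrix N b c = !(N b c) := if_pos hh
    rw [this, ← hh]
    cases N b c <;> simp
  · have hs : switchMatrix N b c = N b c := if_neg hh
    rw [hs]
    rcases hN c with h | h | h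
    · have hb : N b c = false := by
        rw [colOnes, Finset.card_eq_zero, Finset.filter_eq_empty_iff] at h
        simpa using h (Finset.mem_univ b)
      rw [h, hb]; simp
    · exact absurd h hh
    · have hb : N b c = true := by
        rw [colOnes, ← Finset.card_univ, Finset.card_filter_eq_iff] at h
        simpa using h b
      rw [h, hb]
      simp; ring

/-- Switching preserves the column sums, so the degrees of the vertices of `GC`. -/
theorem colOnes_switchMatrix {β γ : Type*} [Fintype β] {N : Matrix β γ Bool}
    (hN : Admissible N) (c : γ) : colOnes (switchMatrix N) c = colOnes N c := by
  rcases isEmpty_or_nonempty β with _ | _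
  · simp [colOnes]
  have h := Finset.sum_congr rfl fun b (_ : b ∈ Finset.univ) => card_mul_add_switchMatrix hN b c
  rw [← Finset.mul_sum, Finset.sum_add_distrib, ← colOnes_eq_sum, ← colOnes_eq_sum,
    Finset.sum_const, Finset.card_univ, nsmul_eq_mul] at h
  have h0 : (Fintype.card β : ℤ) ≠ 0 := by exact_mod_cast Fintype.card_ne_zero
  have := mul_left_cancel₀ h0 h
  omega

theorem sum_rowOnes {β γ : Type*} [Fintype β] [Fintype γ] (N : Matrix β γ Bool) :
    ∑ b, rowOnes N b = ∑ c, (colOnes N c : ℤ) := by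
  simp_rw [colOnes_eq_sum, rowOnes]
  exact Finset.sum_comm

theorem sum_rowOnes_switchMatrix {β γ : Type*} [Fintype β] [Fintype γ] {N : Matrix β γ Bool}
    (hN : Admissible N) : ∑ b, rowOnes (switchMatrix N) b = ∑ b, rowOnes N b := by
  rw [sum_rowOnes, sum_rowOnes]
  exact Finset.sum_congr rfl fun c _ => by rw [colOnes_switchMatrix hN]

/-- Switching reflects the row sums in their mean. -/
theorem rowOnes_switchMatrix {β γ : Type*} [Fintype β] [Fintype γ] {N : Matrix β γ Bool}
    (hN : Admissible N) (b : β) :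
    (Fintype.card β : ℤ) * (rowOnes N b + rowOnes (switchMatrix N) b) =
      2 * ∑ b, rowOnes N b := by
  rw [sum_rowOnes, rowOnes, rowOnes, ← Finset.sum_add_distrib, Finset.mul_sum, Finset.mul_sum]
  exact Finset.sum_congr rfl fun c _ => card_mul_add_switchMatrix hN b c

/-- The vertices of `GC` have the same degree `≥ 2` in the graph and its switch, so that their
factors `1 - deg` are nonzero and cancel from `prod_one_sub_degree_eq_of_iharaZeta_eq`. -/
theorem prod_eq_of_iharaZeta_eq {β γ : Type*} [Fintype β] [Fintype γ] {GB : SimpleGraph β}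
    {GC : SimpleGraph γ} [DecidableRel GB.Adj] [DecidableRel GC.Adj]
    {N : Matrix β γ Bool} (hN : Admissible N) (hmd : GC.IsMd 2)
    (h : (blockGraph GB GC N).iharaZeta = (switchedGraph GB GC N).iharaZeta) :
    ∏ b, (1 - (GB.degree b + rowOnes N b)) =
      ∏ b, (1 - (GB.degree b + rowOnes (switchMatrix N) b)) := by
  classical
  have hp := SimpleGraph.prod_one_sub_degree_eq_of_iharaZeta_eq
    (H := blockGraph GB GC (switchMatrix N)) h (by
    zify
    simp only [Fintype.sum_sum_type, degree_blockGraph_inl, degree_blockGraph_inr,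
      Finset.sum_add_distrib, sum_rowOnes_switchMatrix hN, colOnes_switchMatrix hN])
  simp only [Fintype.prod_sum_type, degree_blockGraph_inl, degree_blockGraph_inr,
    colOnes_switchMatrix hN] at hp
  refine mul_right_cancel₀ (Finset.prod_ne_zero_iff.2 fun c _ => ?_) hp
  have := hmd c
  omega

/-- The analogue of `prod_eq_of_iharaZeta_eq` for cones, where all degrees of vertices other than
the apex go up by one, so that minimal degree `1` suffices. -/
theorem prod_eq_of_coneZeta_eq {β γ : Type*} [Fintype β] [Fintype γ] [Nonempty β]
    {GB : SimpleGraph β} {GC : SimpleGraph γ} [DecidableRel GB.Adj] [DecidableRel GC.Adj]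
    {N : Matrix β γ Bool} (hN : Admissible N) (hmd : GC.IsMd 1)
    (h : (blockGraph GB GC N).coneZeta = (switchedGraph GB GC N).coneZeta) :
    ∏ b, (1 - (GB.degree b + rowOnes N b + 1)) =
      ∏ b, (1 - (GB.degree b + rowOnes (switchMatrix N) b + 1)) := by
  classical
  rcases isEmpty_or_nonempty γ with hγ | hγ
  · simp [rowOnes]
  have hp := SimpleGraph.prod_one_sub_degree_eq_of_iharaZeta_eq
    (H := (blockGraph GB GC (switchMatrix N)).cone) h (by
    zify
    simp only [Fintype.sum_sum_type, SimpleGraph.degree_cone_inl,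
      SimpleGraph.degree_cone_inr, Fintype.sum_unique, PUnit.default_eq_unit,
      degree_blockGraph_inl, degree_blockGraph_inr,
      Finset.sum_add_distrib, sum_rowOnes_switchMatrix hN, colOnes_switchMatrix hN])
  simp only [Fintype.prod_sum_type, SimpleGraph.degree_cone_inl,
    SimpleGraph.degree_cone_inr, Fintype.prod_unique, PUnit.default_eq_unit,
    degree_blockGraph_inl, degree_blockGraph_inr, colOnes_switchMatrix hN] at hp
  have hcard : (1 - (Fintype.card (β ⊕ γ) : ℤ)) ≠ 0 := by
    have h1 := Fintype.card_pos (α := β)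
    have h2 := Fintype.card_pos (α := γ)
    rw [Fintype.card_sum]
    omega
  refine mul_right_cancel₀ (Finset.prod_ne_zero_iff.2 fun c _ => ?_) (mul_right_cancel₀ hcard hp)
  have := hmd c
  omega

/-! ### The exceptional matrices -/

/-- The columns allowed in a GM-admissible matrix with four rows. -/
abbrev Column : Type :=
  {v : Fin 4 → Bool // (Finset.univ.filter fun b => v b = true).card = 0 ∨
    2 * (Finset.univ.filter fun b => v b = true).card = 4 ∨
    (Finset.univ.filter fun b => v b = true).card = 4}

/-- A linear form with coefficients `k`, evaluated on a column. -/
def columnWeight (k : Fin 4 → ℤ) (v : Column) : ℤ := ∑ b, k b * (v.1 b).toNat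

/-- Admissible matrices as words of columns. -/
def admissibleEquiv (n : ℕ) :
    {N : Matrix (Fin 4) (Fin n) Bool // Admissible N} ≃ (Fin n → Column) where
  toFun N c := ⟨fun b => N.1 b c, N.2 c⟩
  invFun w := ⟨fun b c => (w c).1 b, fun c => (w c).2⟩
  left_inv _ := rfl
  right_inv _ := rfl

theorem sum_columnWeight {n : ℕ} (k : Fin 4 → ℤ)
    (N : {N : Matrix (Fin 4) (Fin n) Bool // Admissible N}) :
    ∑ c, columnWeight k (admissibleEquiv n N c) = ∑ b, k b * rowOnes N.1 b := by
  simp only [columnWeight, admissibleEquiv, rowOnes, Finset.mul_sum, Equiv.coe_fn_mk]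
  exact Finset.sum_comm

theorem ncard_admissible (n : ℕ) :
    {N : Matrix (Fin 4) (Fin n) Bool | Admissible N}.ncard = Fintype.card Column ^ n := by
  have : Nat.card {N : Matrix (Fin 4) (Fin n) Bool // Admissible N} = Fintype.card Column ^ n := by
    rw [Nat.card_congr (admissibleEquiv n), Nat.card_eq_fintype_card, Fintype.card_fun,
      Fintype.card_fin]
  exact this

/-- The coefficients of the linear forms, one of which must take a prescribed value on the row sums
of `N` for the graph and its switch to have the same zeta function. -/
def rowForm : Fin 4 → Fin 4 → ℤ :=
  ![![1, 1, 1, 1], ![1, 1, -1, -1], ![1, -1, 1, -1], ![1, -1, -1, 1]]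

theorem exists_columnWeight_ne (i : Fin 4) :
    ∃ a b : Column, columnWeight (rowForm i) a ≠ columnWeight (rowForm i) b := by
  fin_cases i
  · exact ⟨⟨![true, true, true, true], by decide⟩, ⟨fun _ => false, by decide⟩, by decide⟩
  · exact ⟨⟨![true, true, false, false], by decide⟩, ⟨fun _ => false, by decide⟩, by decide⟩
  · exact ⟨⟨![true, false, true, false], by decide⟩, ⟨fun _ => false, by decide⟩, by decide⟩
  · exact ⟨⟨![true, false, false, true], by decide⟩, ⟨fun _ => false, by decide⟩, by decide⟩

/-- If `y₀ + y₁ + y₂ + y₃ = 0`, the product of the numbers `m + y_b` equals that of the numbers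
`m - y_b` only if `m e₃(y) = 0`, where `e₃(y) = (y₀ + y₁) (y₀ + y₂) (y₀ + y₃)`. The
reflection in the mean `m` is what switching does to the degrees of the four vertices. The sum
`rowForm 0` corresponds to `m = 0` and the three others to the factors of `e₃`. -/
theorem exists_rowForm_eq {x y : Fin 4 → ℤ} {K : ℤ}
    (hxy : ∀ b, 4 * (x b + y b) = 2 * ∑ b, x b)
    (h : ∏ b, (K + x b) = ∏ b, (K + y b)) :
    ∃ i, ∑ b, rowForm i b * x b = ![-4 * K, 0, 0, 0] i := by
  simp only [Fin.sum_univ_four, Fin.prod_univ_four] at hxy h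
  have e : ∀ b, 2 * y b = (x 0 + x 1 + x 2 + x 3) - 2 * x b := fun b => by
    have := hxy b; omega
  have key : (x 0 + x 1 + x 2 + x 3 + 4 * K) * (x 0 + x 1 - x 2 - x 3) *
      (x 0 - x 1 + x 2 - x 3) * (x 0 - x 1 - x 2 + x 3) = 0 := by
    -- Clearing the denominator: `2 * y b` is an integral linear form in `x`, but `y b` is not.
    have h16 : (2 * K + 2 * x 0) * (2 * K + 2 * x 1) * (2 * K + 2 * x 2) * (2 * K + 2 * x 3) =
        (2 * K + 2 * y 0) * (2 * K + 2 * y 1) * (2 * K + 2 * y 2) * (2 * K + 2 * y 3) := by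
      linear_combination 16 * h
    rw [e 0, e 1, e 2, e 3] at h16
    linear_combination h16
  rcases mul_eq_zero.1 key with h1 | h1
  · rcases mul_eq_zero.1 h1 with h2 | h2
    · rcases mul_eq_zero.1 h2 with h3 | h3
      · exact ⟨0, by simp [rowForm, Fin.sum_univ_four]; linarith⟩
      · exact ⟨1, by simp [rowForm, Fin.sum_univ_four]; linarith⟩
    · exact ⟨2, by simp [rowForm, Fin.sum_univ_four]; linarith⟩
  · exact ⟨3, by simp [rowForm, Fin.sum_univ_four]; linarith⟩

/-- An invariant that separates an admissible `N` from its switch unless the row sums of `N`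
satisfy the equation `∏ (K + r_b) = ∏ (K + r̃_b)` separates almost all of them. -/
theorem exists_forall_abs_distinguishedProportion_sub_one_lt {ε : ℝ} (hε : 0 < ε) :
    ∃ n₀ : ℕ, ∀ n ≥ n₀, ∀ (GB : SimpleGraph (Fin 4)) (GC : SimpleGraph (Fin n))
      (Z : SimpleGraph (Fin 4 ⊕ Fin n) → PowerSeries ℂ) (K : ℤ),
      (∀ N : Matrix (Fin 4) (Fin n) Bool, Admissible N →
        Z (blockGraph GB GC N) = Z (switchedGraph GB GC N) →
        ∏ b, (K + rowOnes N b) = ∏ b, (K + rowOnes (switchMatrix N) b)) →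
      |distinguishedProportion GB GC Z - 1| < ε := by
  -- Each of the four exceptional events gets proportion at most `ε / 5`, so that `4 * (ε / 5) < ε`.
  have hε5 : 0 < ε / 5 := by positivity
  have hw : ∀ i : Fin 4, ∃ n₀ : ℕ, ∀ n ≥ n₀, ∀ v : ℤ,
      (Nat.card {N : Fin n → Column // ∑ c, columnWeight (rowForm i) (N c) = v} : ℝ) ≤
        ε / 5 * (Fintype.card Column : ℝ) ^ n := by
    intro i
    obtain ⟨a, b, hab⟩ := exists_columnWeight_ne i
    exact exists_forall_card_sum_weight_le _ hab hε5
  choose n₀ hn₀ using hw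
  refine ⟨Finset.univ.sup n₀, fun n hn GB GC Z K hZ => ?_⟩
  set T : Set (Matrix (Fin 4) (Fin n) Bool) := {N | Admissible N} with hT
  set S : Set (Matrix (Fin 4) (Fin n) Bool) :=
    {N | Admissible N ∧ Z (blockGraph GB GC N) ≠ Z (switchedGraph GB GC N)} with hS
  let E : Fin 4 → Set (Matrix (Fin 4) (Fin n) Bool) := fun i =>
    {N | Admissible N ∧ ∑ b, rowForm i b * rowOnes N b = ![-4 * K, 0, 0, 0] i}
  have hTc : (T.ncard : ℝ) = (Fintype.card Column : ℝ) ^ n := by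
    rw [hT, ncard_admissible, Nat.cast_pow]
  have hTpos : (0 : ℝ) < T.ncard := by
    rw [hTc]
    have : 0 < Fintype.card Column := Fintype.card_pos_iff.2 ⟨⟨fun _ => false, by decide⟩⟩
    positivity
  -- Each exceptional event fixes the value of a nonconstant weight, so it is rare.
  have hE : ∀ i, ((E i).ncard : ℝ) ≤ ε / 5 * T.ncard := by
    intro i
    rw [hTc]
    refine le_trans ?_ (hn₀ i n ((Finset.le_sup (Finset.mem_univ i)).trans hn)
      (![-4 * K, 0, 0, 0] i))
    rw [Nat.cast_le]
    refine Nat.card_le_card_of_injective (fun N : E i => ⟨admissibleEquiv n ⟨N.1, N.2.1⟩, by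
      rw [sum_columnWeight]; exact N.2.2⟩) ?_
    intro N N' hNN
    have h1 := Subtype.ext_iff.1 ((admissibleEquiv n).injective (congrArg Subtype.val hNN))
    exact Subtype.ext h1
  have hsub : T ⊆ S ∪ ⋃ i, E i := by
    intro N hN
    by_cases hz : Z (blockGraph GB GC N) = Z (switchedGraph GB GC N)
    · right
      have hxy := fun b => rowOnes_switchMatrix hN b
      simp only [Fintype.card_fin] at hxy
      obtain ⟨i, hi⟩ := exists_rowForm_eq hxy (hZ N hN hz)
      exact Set.mem_iUnion.2 ⟨i, hN, hi⟩
    · exact Or.inl ⟨hN, hz⟩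
  have hle : (T.ncard : ℝ) ≤ S.ncard + ∑ i, ((E i).ncard : ℝ) := by
    have h1 := Set.ncard_le_ncard hsub (Set.toFinite _)
    have h2 := Set.ncard_union_le S (⋃ i, E i)
    have h3 := Set.ncard_iUnion_le_of_fintype E
    exact_mod_cast h1.trans (h2.trans (Nat.add_le_add_left h3 _))
  have hST : (S.ncard : ℝ) ≤ T.ncard := by
    exact_mod_cast Set.ncard_le_ncard (show S ⊆ T from fun N hN => hN.1) (Set.toFinite _)
  have hsum : ∑ i, ((E i).ncard : ℝ) ≤ 4 * (ε / 5 * T.ncard) := by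
    refine (Finset.sum_le_sum fun i _ => hE i).trans ?_
    simp
  have hq : distinguishedProportion GB GC Z = (S.ncard : ℝ) / T.ncard := rfl
  rw [hq, abs_sub_comm, abs_of_nonneg (sub_nonneg.2 ((div_le_one hTpos).2 hST)), sub_lt_comm,
    lt_div_iff₀ hTpos]
  nlinarith [mul_pos hε hTpos]

end GMSwitching

theorem mainTheorem3 :
    (∀ ε : ℝ, 0 < ε → ∃ n₀ : ℕ, ∀ n : ℕ, n₀ ≤ n →
      ∀ (GB : SimpleGraph (Fin 4)) [DecidableRel GB.Adj]
        (GC : SimpleGraph (Fin n)) [DecidableRel GC.Adj],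
        (∃ d : ℕ, GB.IsRegularOfDegree d) → GC.IsMd 1 →
          |GMSwitching.distinguishedProportion GB GC SimpleGraph.coneZeta - 1| < ε) ∧
    (∀ ε : ℝ, 0 < ε → ∃ n₀ : ℕ, ∀ n : ℕ, n₀ ≤ n →
      ∀ (GB : SimpleGraph (Fin 4)) [DecidableRel GB.Adj]
        (GC : SimpleGraph (Fin n)) [DecidableRel GC.Adj],
        (∃ d : ℕ, GB.IsRegularOfDegree d) → GC.IsMd 2 →
          |GMSwitching.distinguishedProportion GB GC SimpleGraph.iharaZeta - 1| < ε) := by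
  constructor
  · intro ε hε
    obtain ⟨n₀, h₀⟩ := GMSwitching.exists_forall_abs_distinguishedProportion_sub_one_lt hε
    -- In the cone the vertex `b` of `GB` has degree `d + 1 + rowOnes N b`.
    refine ⟨n₀, fun n hn GB _ GC _ ⟨d, hd⟩ hmd => h₀ n hn GB GC _ d fun N hN hz => ?_⟩
    have hp := GMSwitching.prod_eq_of_coneZeta_eq hN hmd hz
    simp only [Fin.prod_univ_four, hd.degree_eq] at hp ⊢
    linear_combination hp
  · intro ε hε
    obtain ⟨n₀, h₀⟩ := GMSwitching.exists_forall_abs_distinguishedProportion_sub_one_lt hε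
    refine ⟨n₀, fun n hn GB _ GC _ ⟨d, hd⟩ hmd => h₀ n hn GB GC _ (d - 1) fun N hN hz => ?_⟩
    have hp := GMSwitching.prod_eq_of_iharaZeta_eq hN hmd hz
    simp only [Fin.prod_univ_four, hd.degree_eq] at hp ⊢
    linear_combination hp
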